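/- \textbf{Theorem (Representation Formula).} Let $\mathbb{O}$ be the real algebra of octonions with its standard basis $e_0=1,e_1,\dots,e_7$, that is, $e_ie_j=-\delta_{ij}+\sum_{k=1}^{7}\epsilon_{ijk}e_k$ for $1\le i,j\le 7$, where $\epsilon$ is the totally antisymmetric symbol with $\epsilon_{ijk}=1$ for $(i,j,k)\in\{(1,2,3),(1,4,5),(2,4,6),(3,4,7),(5,3,6),(6,1,7),(7,2,5)\}$ and $\epsilon_{ijk}=0$ unless $(i,j,k)$ is a permutation of one of these triples. Let $p\in\{0,1,\dots,6\}$, identify $\mathbb{R}^{p+1}$ with $\{\sum_{i=0}^{p}x_ie_i : x_i\in\mathbb{R}\}\subset\mathbb{O}$, and let $\mathbb{S}=\{\sum_{i=p+1}^{7}x_ie_i:\sum_{i=p+1}^{7}x_i^2=1\}$. For $\Omega\subseteq\mathbb{O}$ and $\underline{\omega}\in\mathbb{S}$ put $\Omega_{\underline{\omega}}=\Omega\cap(\mathbb{R}^{p+1}\oplus\underline{\omega}\mathbb{R})$, regarded as a subset of $\mathbb{R}^{p+2}$ through the coordinates $(x_p,r)\mapsto x_p+r\underline{\omega}$. A domain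 is a nonempty connected open set. Let $\Omega\subseteq\mathbb{O}$ be a domain which is (a) a slice domain: $\Omega\cap\mathbb{R}^{p+1}\ne\emptyset$, and $\Omega_{\underline{\omega}}$ is a domain in $\mathbb{R}^{p+2}$ for every $\underline{\omega}\in\mathbb{S}$; (b) $p$-symmetric: if $x_p\in\mathbb{R}^{p+1}$, $r>0$, $\underline{\omega}\in\mathbb{S}$ and $x_p+r\underline{\omega}\in\Omega$, then $x_p+r\underline{\eta}\in\Omega$ for all $\underline{\eta}\in\mathbb{S}$. Let $f:\Omega\to\mathbb{O}$ be (left) generalized partial-slice monogenic of type $p$: for every $\underline{\omega}\in\mathbb{S}$ the restriction $f_{\underline{\omega}}$ of $f$ to $\Omega_{\underline{\omega}}$ is of class $C^1$ in the coordinates $(x_0,\dots,x_p,r)$ and satisfies $$\sum_{i=0}^{p}e_i\,\partial_{x_i}f_{\underline{\omega}}(x_p+r\underline{\omega})+\underline{\omega}\,\partial_rf_{\underline{\omega}}(x_p+r\underline{\omega})=0\qquad\text{for all } x_p+r\underline{\omega}\in\Omega_{\underline{\omega}}.$$ Then, for all $\underline{\omega}\in\mathbb{S}$, $x_p\in\mathbb{R}^{p+1}$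 and $r\in\mathbb{R}$ with $x_p+r\underline{\omega}\in\Omega$, and for all $\underline{\eta}\in\mathbb{S}$, $$f(x_p+r\underline{\omega})=\tfrac12\bigl(f(x_p+r\underline{\eta})+f(x_p-r\underline{\eta})\bigr)+\tfrac12\,\underline{\omega}\Bigl(\underline{\eta}\bigl(f(x_p-r\underline{\eta})-f(x_p+r\underline{\eta})\bigr)\Bigr).$$ Moreover, for all $x_p\in\mathbb{R}^{p+1}$ and $r\in\mathbb{R}$ such that $x_p+r\underline{\omega}\in\Omega$ for some $\underline{\omega}\in\mathbb{S}$, the two values $$F_1(x_p,r)=\tfrac12\bigl(f(x_p+r\underline{\eta})+f(x_p-r\underline{\eta})\bigr),\qquad F_2(x_p,r)=\tfrac12\,\underline{\eta}\bigl(f(x_p-r\underline{\eta})-f(x_p+r\underline{\eta})\bigr)$$ do not depend on the choice of $\underline{\eta}\in\mathbb{S}$. -/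

import Mathlib

/-- The real vector space underlying the octonions, with its Euclidean norm; the coordinates of
`x` are `x 0, …, x 7`, that is, `x = x₀ + ∑ xᵢ eᵢ`. -/
abbrev Octonion : Type := EuclideanSpace ℝ (Fin 8)

namespace Octonion

/-- The triples `(i, j, k)` with `eᵢ eⱼ = eₖ` from which the multiplication table is generated. -/
def triples : Finset (Fin 8 × Fin 8 × Fin 8) :=
  {(1, 2, 3), (1, 4, 5), (2, 4, 6), (3, 4, 7), (5, 3, 6), (6, 1, 7), (7, 2, 5)}

/-- The totally antisymmetric symbol `ε i j k`: the sign of the permutation which carries a triple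
of the list to `(i, j, k)`, and `0` if there is none. The three even permutations are the cyclic
ones, and the odd ones are these followed by exchanging the first two entries. -/
def eps (i j k : Fin 8) : ℤ :=
  if (i, j, k) ∈ triples ∨ (j, k, i) ∈ triples ∨ (k, i, j) ∈ triples then 1
  else if (j, i, k) ∈ triples ∨ (i, k, j) ∈ triples ∨ (k, j, i) ∈ triples then -1
  else 0

/-- The coefficient of `eₖ` in the product `eᵢ eⱼ`: `e₀ = 1` is the unit, and
`eᵢ eⱼ = -δᵢⱼ + ∑ₖ εᵢⱼₖ eₖ` for `i, j ≥ 1`. -/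
def structConst (i j k : Fin 8) : ℤ :=
  if i = 0 then (if j = k then 1 else 0)
  else if j = 0 then (if i = k then 1 else 0)
  else if k = 0 then (if i = j then -1 else 0)
  else eps i j k

/-- Octonion multiplication: the bilinear extension of the multiplication table. -/
noncomputable instance instMulOctonion : Mul Octonion where
  mul x y := WithLp.toLp 2 fun k => ∑ i, ∑ j, (structConst i j k : ℝ) * (x i * y j)

/-- The inclusion of `ℝ^{p+1}` into the octonions, `(x₀, …, x_p) ↦ ∑_{i ≤ p} xᵢ eᵢ`
(used for `p ≤ 6`). -/
noncomputable def incl (p : ℕ) (x : EuclideanSpace ℝ (Fin (p + 1))) : Octonion :=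
  WithLp.toLp 2 fun j => if h : j.val < p + 1 then x ⟨j.val, h⟩ else 0

/-- The sphere `𝕊` of the `∑_{i > p} xᵢ eᵢ` with `∑_{i > p} xᵢ² = 1`. -/
def sphere (p : ℕ) : Set Octonion :=
  {ω | (∀ i : Fin 8, i.val ≤ p → ω i = 0) ∧ ∑ i, ω i ^ 2 = 1}

/-- The slice `Ω_ω = Ω ∩ (ℝ^{p+1} ⊕ ω ℝ)`, in the coordinates `(x_p, r)` of
`x_p + r ω`. -/
def slice (p : ℕ) (Ω : Set Octonion) (ω : Octonion) : Set (EuclideanSpace ℝ (Fin (p + 1)) × ℝ) :=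
  {z | incl p z.1 + z.2 • ω ∈ Ω}

/-- The restriction `f_ω` of `f` to the slice, `(x_p, r) ↦ f (x_p + r ω)`. -/
noncomputable def sliceFun (p : ℕ) (f : Octonion → Octonion) (ω : Octonion) :
    EuclideanSpace ℝ (Fin (p + 1)) × ℝ → Octonion :=
  fun z => f (incl p z.1 + z.2 • ω)

/-- The operator `(∑_{i ≤ p} eᵢ ∂_{xᵢ} + ω ∂_r) F`, acting from the left. -/
noncomputable def sliceDirac (p : ℕ) (ω : Octonion)
    (F : EuclideanSpace ℝ (Fin (p + 1)) × ℝ → Octonion)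
    (z : EuclideanSpace ℝ (Fin (p + 1)) × ℝ) : Octonion :=
  (∑ i : Fin (p + 1), incl p (EuclideanSpace.single i 1) *
      fderiv ℝ F z (EuclideanSpace.single i 1, 0)) +
    ω * fderiv ℝ F z (0, 1)

/-- (Left) generalized partial-slice monogenic functions of type `p` on `Ω`. Only the values of
`f` on `Ω` matter. -/
def IsPartialSliceMonogenicOn (p : ℕ) (f : Octonion → Octonion) (Ω : Set Octonion) : Prop :=
  ∀ ω ∈ sphere p, ContDiffOn ℝ 1 (sliceFun p f ω) (slice p Ω ω) ∧
    ∀ z ∈ slice p Ω ω, sliceDirac p ω (sliceFun p f ω) z = 0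

/-- Slice domains: domains which meet `ℝ^{p+1}` and all of whose slices are domains. -/
structure IsSliceDomain (p : ℕ) (Ω : Set Octonion) : Prop where
  isOpen : IsOpen Ω
  isConnected : IsConnected Ω
  inter_nonempty : (Ω ∩ Set.range (incl p)).Nonempty
  isOpen_slice : ∀ ω ∈ sphere p, IsOpen (slice p Ω ω)
  isConnected_slice : ∀ ω ∈ sphere p, IsConnected (slice p Ω ω)

/-- Partial symmetry with respect to `ℝ^{p+1}`. -/
def IsPSymmetric (p : ℕ) (Ω : Set Octonion) : Prop :=
  ∀ (x : EuclideanSpace ℝ (Fin (p + 1))) (r : ℝ), 0 < r → ∀ ω ∈ sphere p,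
    incl p x + r • ω ∈ Ω → ∀ η ∈ sphere p, incl p x + r • η ∈ Ω

/-- `F₁ (x_p, r) = (f (x_p + r η) + f (x_p - r η)) / 2`, computed with `η`. -/
noncomputable def stemFst (p : ℕ) (f : Octonion → Octonion) (η : Octonion)
    (x : EuclideanSpace ℝ (Fin (p + 1))) (r : ℝ) : Octonion :=
  (1 / 2 : ℝ) • (f (incl p x + r • η) + f (incl p x - r • η))

/-- `F₂ (x_p, r) = η (f (x_p - r η) - f (x_p + r η)) / 2`, computed with `η`. -/
noncomputable def stemSnd (p : ℕ) (f : Octonion → Octonion) (η : Octonion)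
    (x : EuclideanSpace ℝ (Fin (p + 1))) (r : ℝ) : Octonion :=
  (1 / 2 : ℝ) • (η * (f (incl p x - r • η) - f (incl p x + r • η)))

end Octonion

/-! ### Octonion arithmetic: coordinates and the Clifford relations of left multiplications. -/

namespace Octonion

/-! Write `f_ω` for the restriction to the slice of `ω`. The right-hand side of the formula, built
from `f_η`, is a function `stemExtension` on the slice of `ω` that agrees with `f_ω` at `r = 0`.
Non-associativity is avoided by working only with left multiplications: those by `ω` and by `η`
square to `-1` and anticommute with those by `e₁, …, e_p`, so `x ↦ ω (η x)` commutes with every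
`eᵢ`, and `stemExtension` solves the equation of the slice of `ω` (`sliceDirac_stemExtension`). The
difference is then a null solution vanishing on the hyperplane `r = 0`, and an identity theorem
finishes (`eqOn_zero_of_eqOn_hyperplane`).

The identity theorem is proved for any first order operator `∑ eᵢ ∂ᵢ` with `eᵢ† eⱼ + eⱼ† eᵢ = 2
δᵢⱼ`, without power series. Null solutions have a mean value property against a radial bump
(`integral_bump_smul_eq`), hence are smooth and satisfy gradient estimates. Iterated, these bound
`k`-th derivatives by `C ^ k * k ^ k`, so a solution vanishing near a point vanishes on a ball of
proportionate radius, which propagates over connected sets. For the hyperplane, the solution is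
replaced by zero on one side; the result is still a `C¹` null solution. -/

theorem mul_apply (x y : Octonion) (k : Fin 8) :
    (x * y) k = ∑ i, ∑ j, (structConst i j k : ℝ) * (x i * y j) := rfl

theorem mul_apply_zero (x y : Octonion) : (x * y) 0 =
    x 0 * y 0 - x 1 * y 1 - x 2 * y 2 - x 3 * y 3 - x 4 * y 4
      - x 5 * y 5 - x 6 * y 6 - x 7 * y 7 := by
  rw [mul_apply]
  simp [Fin.sum_univ_eight, structConst]
  ring

theorem mul_apply_one (x y : Octonion) : (x * y) 1 =
    x 0 * y 1 + x 1 * y 0 + x 2 * y 3 - x 3 * y 2 + x 4 * y 5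
      - x 5 * y 4 + x 7 * y 6 - x 6 * y 7 := by
  rw [mul_apply]
  simp [Fin.sum_univ_eight, structConst, eps, triples]
  ring

theorem mul_apply_two (x y : Octonion) : (x * y) 2 =
    x 0 * y 2 + x 2 * y 0 + x 3 * y 1 - x 1 * y 3 + x 4 * y 6
      - x 6 * y 4 + x 5 * y 7 - x 7 * y 5 := by
  rw [mul_apply]
  simp [Fin.sum_univ_eight, structConst, eps, triples]
  ring

theorem mul_apply_three (x y : Octonion) : (x * y) 3 =
    x 0 * y 3 + x 3 * y 0 + x 1 * y 2 - x 2 * y 1 + x 4 * y 7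
      - x 7 * y 4 + x 6 * y 5 - x 5 * y 6 := by
  rw [mul_apply]
  simp [Fin.sum_univ_eight, structConst, eps, triples]
  ring

theorem mul_apply_four (x y : Octonion) : (x * y) 4 =
    x 0 * y 4 + x 4 * y 0 + x 5 * y 1 - x 1 * y 5 + x 6 * y 2
      - x 2 * y 6 + x 7 * y 3 - x 3 * y 7 := by
  rw [mul_apply]
  simp [Fin.sum_univ_eight, structConst, eps, triples]
  ring

theorem mul_apply_five (x y : Octonion) : (x * y) 5 =
    x 0 * y 5 + x 5 * y 0 + x 1 * y 4 - x 4 * y 1 + x 3 * y 6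
      - x 6 * y 3 + x 7 * y 2 - x 2 * y 7 := by
  rw [mul_apply]
  simp [Fin.sum_univ_eight, structConst, eps, triples]
  ring

theorem mul_apply_six (x y : Octonion) : (x * y) 6 =
    x 0 * y 6 + x 6 * y 0 + x 2 * y 4 - x 4 * y 2 + x 5 * y 3
      - x 3 * y 5 + x 1 * y 7 - x 7 * y 1 := by
  rw [mul_apply]
  simp [Fin.sum_univ_eight, structConst, eps, triples]
  ring

theorem mul_apply_seven (x y : Octonion) : (x * y) 7 =
    x 0 * y 7 + x 7 * y 0 + x 3 * y 4 - x 4 * y 3 + x 6 * y 1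
      - x 1 * y 6 + x 2 * y 5 - x 5 * y 2 := by
  rw [mul_apply]
  simp [Fin.sum_univ_eight, structConst, eps, triples]
  ring

/-- Left multiplication by an octonion, as a linear map. -/
noncomputable def leftMul (a : Octonion) : Octonion →ₗ[ℝ] Octonion where
  toFun x := a * x
  map_add' x y := by
    ext k
    simp only [mul_apply, PiLp.add_apply, mul_add, Finset.sum_add_distrib]
  map_smul' c x := by
    ext k
    simp only [mul_apply, PiLp.smul_apply, smul_eq_mul, Finset.mul_sum, RingHom.id_apply]
    refine Finset.sum_congr rfl fun i _ => Finset.sum_congr rfl fun j _ => by ring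

@[simp]
theorem leftMul_apply (a x : Octonion) : leftMul a x = a * x := rfl

theorem mul_add' (a x y : Octonion) : a * (x + y) = a * x + a * y := map_add (leftMul a) x y

theorem mul_sub' (a x y : Octonion) : a * (x - y) = a * x - a * y := map_sub (leftMul a) x y

theorem mul_smul' (a : Octonion) (c : ℝ) (x : Octonion) : a * (c • x) = c • (a * x) :=
  map_smul (leftMul a) c x

theorem mul_neg' (a x : Octonion) : a * (-x) = -(a * x) := map_neg (leftMul a) x

theorem mul_zero' (a : Octonion) : a * 0 = 0 := map_zero (leftMul a)

theorem mul_sum' {ι : Type*} (s : Finset ι) (a : Octonion) (x : ι → Octonion) :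
    a * ∑ i ∈ s, x i = ∑ i ∈ s, a * x i := map_sum (leftMul a) x s

theorem neg_mul' (a x : Octonion) : (-a) * x = -(a * x) := by
  ext k
  simp only [mul_apply, PiLp.neg_apply, neg_mul, mul_neg, Finset.sum_neg_distrib]

/-- The unit of the octonions. -/
theorem single_zero_mul (x : Octonion) : (EuclideanSpace.single 0 1 : Octonion) * x = x := by
  ext k
  fin_cases k <;>
    simp [mul_apply_zero, mul_apply_one, mul_apply_two, mul_apply_three, 
      mul_apply_four, mul_apply_five, mul_apply_six, mul_apply_seven]

/-- The conjugate of an octonion. -/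
noncomputable def conj (a : Octonion) : Octonion :=
  WithLp.toLp 2 fun k => if k = 0 then a k else -a k

theorem conj_apply (a : Octonion) (k : Fin 8) : conj a k = if k = 0 then a k else -a k := rfl

theorem conj_eq_neg {a : Octonion} (ha : a 0 = 0) : conj a = -a := by
  ext k
  rw [conj_apply, PiLp.neg_apply]
  split_ifs with h
  · rw [h, ha, neg_zero]
  · rfl

/-- The Clifford relations for left multiplications. -/
theorem conj_mul_mul_add (a b x : Octonion) :
    conj a * (b * x) + conj b * (a * x) = (2 * ∑ i, a i * b i) • x := by
  -- This polarises `conj a * (a * x) = |a|² x`; coordinates replace any appeal to alternativity.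
  ext k
  fin_cases k <;>
    simp only [Fin.zero_eta, Fin.mk_one, Fin.reduceFinMk, PiLp.add_apply, PiLp.smul_apply,
      smul_eq_mul, Fin.sum_univ_eight, mul_apply_zero, mul_apply_one,
      mul_apply_two, mul_apply_three, mul_apply_four, mul_apply_five, mul_apply_six, mul_apply_seven,
      conj_apply, if_true, Fin.reduceEq, if_false] <;>
    ring

theorem mul_mul_add_mul_mul (a b x : Octonion) (ha : a 0 = 0) (hb : b 0 = 0) :
    a * (b * x) + b * (a * x) = (-2 * ∑ i, a i * b i) • x := by
  have h := conj_mul_mul_add a b x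
  rw [conj_eq_neg ha, conj_eq_neg hb, neg_mul', neg_mul'] at h
  rw [neg_mul, neg_smul, ← h]
  abel

theorem mul_mul_comm_neg (a b x : Octonion) (ha : a 0 = 0) (hb : b 0 = 0)
    (hab : ∑ i, a i * b i = 0) : a * (b * x) = -(b * (a * x)) := by
  have h := mul_mul_add_mul_mul a b x ha hb
  rw [hab, mul_zero, zero_smul] at h
  exact eq_neg_of_add_eq_zero_left h

theorem mul_mul_self_neg (a x : Octonion) (ha : a 0 = 0) (h1 : ∑ i, a i ^ 2 = 1) :
    a * (a * x) = -x := by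
  have h := mul_mul_add_mul_mul a a x ha ha
  simp only [← pow_two, h1] at h
  have h2 : (2 : ℝ) • (a * (a * x)) = (2 : ℝ) • (-x) := by
    rw [two_smul, h]; module
  exact smul_right_injective _ two_ne_zero h2

end Octonion

/-! ### Operators of Dirac type: the mean value property. -/

section Dirac

open MeasureTheory Metric Set Filter Topology

/-- The data of a first order operator `∑ i, eᵢ ∂ᵢ` with constant coefficients whose symbol
satisfies `eᵢ† eⱼ + eⱼ† eᵢ = 2 δᵢⱼ`, in the coordinates of a basis of `E`. -/
structure DiracFrame (ι E H : Type*) [Fintype ι] [DecidableEq ι] [NormedAddCommGroup E]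
    [NormedSpace ℝ E] [NormedAddCommGroup H] [NormedSpace ℝ H] where
  /-- The basis vectors. -/
  vec : ι → E
  /-- The coordinates. -/
  coord : ι → E →L[ℝ] ℝ
  /-- The coefficients of the operator. -/
  symb : ι → H →L[ℝ] H
  /-- The adjoint coefficients. -/
  adj : ι → H →L[ℝ] H
  sum_coord : ∀ z, ∑ i, coord i z • vec i = z
  coord_vec : ∀ i j, coord i (vec j) = if i = j then 1 else 0
  norm_sq_le : ∀ z, ‖z‖ ^ 2 ≤ ∑ i, coord i z ^ 2
  clifford : ∀ i j h, adj i (symb j h) + adj j (symb i h) = if i = j then (2 : ℝ) • h else 0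

namespace DiracFrame

variable {ι E H : Type*} [Fintype ι] [DecidableEq ι] [NormedAddCommGroup E]
    [NormedSpace ℝ E] [NormedAddCommGroup H] [NormedSpace ℝ H] (S : DiracFrame ι E H)

/-- The operator `∑ i, eᵢ ∂ᵢ`. -/
noncomputable def dirac (u : E → H) (z : E) : H := ∑ i, S.symb i (fderiv ℝ u z (S.vec i))

/-- A radial bump function supported in the unit ball. -/
noncomputable def bump (y : E) : ℝ := Real.smoothTransition (1 - ∑ i, S.coord i y ^ 2)

theorem contDiff_bump {n : ℕ∞} : ContDiff ℝ n S.bump :=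
  Real.smoothTransition.contDiff.comp
    (contDiff_const.sub (ContDiff.sum fun i _ => (S.coord i).contDiff.pow 2))

theorem continuous_bump : Continuous S.bump := (S.contDiff_bump (n := 0)).continuous

theorem bump_nonneg (y : E) : 0 ≤ S.bump y := Real.smoothTransition.nonneg _

theorem bump_neg (y : E) : S.bump (-y) = S.bump y := by simp [bump]

theorem norm_lt_one_of_bump_ne_zero {y : E} (h : S.bump y ≠ 0) : ‖y‖ < 1 := by
  by_contra! h1
  refine h (Real.smoothTransition.zero_of_nonpos ?_)
  nlinarith [S.norm_sq_le y]

theorem hasCompactSupport_bump [FiniteDimensional ℝ E] : HasCompactSupport S.bump :=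
  HasCompactSupport.of_support_subset_isCompact (isCompact_closedBall (0 : E) 1) fun y hy => by
    simpa using (S.norm_lt_one_of_bump_ne_zero hy).le

theorem fderiv_bump (y : E) (j : ι) : fderiv ℝ S.bump y (S.vec j) =
    deriv Real.smoothTransition (1 - ∑ i, S.coord i y ^ 2) * (-2 * S.coord j y) := by
  have h1 : HasFDerivAt (fun y => 1 - ∑ i, S.coord i y ^ 2)
      (-∑ i, (2 * S.coord i y) • S.coord i) y := by
    refine (HasFDerivAt.fun_sum fun i _ => ?_).const_sub 1
    simpa using ((S.coord i).hasFDerivAt (x := y)).pow 2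
  have h2 : HasDerivAt Real.smoothTransition
      (deriv Real.smoothTransition (1 - ∑ i, S.coord i y ^ 2)) (1 - ∑ i, S.coord i y ^ 2) :=
    ((Real.smoothTransition.contDiff (n := 1)).differentiable (by simp) _).hasDerivAt
  have h3 := (h2.comp_hasFDerivAt y h1).fderiv
  have h4 : (Real.smoothTransition ∘ fun y => 1 - ∑ i, S.coord i y ^ 2) = S.bump := rfl
  rw [h4] at h3
  rw [h3]
  simp [S.coord_vec]

variable [FiniteDimensional ℝ E] [MeasurableSpace E] [BorelSpace E] (μ : Measure E)
  [μ.IsAddHaarMeasure]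

theorem integral_bump_pos : 0 < ∫ y, S.bump y ∂μ := by
  refine (integral_pos_iff_support_of_nonneg S.bump_nonneg
    (S.continuous_bump.integrable_of_hasCompactSupport S.hasCompactSupport_bump)).2 ?_
  refine (S.continuous_bump.isOpen_support).measure_pos μ ⟨0, ?_⟩
  simp [bump]

variable {S}

/-- Integration by parts against a compactly supported function on a rescaled ball. -/
theorem smul_integral_smul_fderiv {g : E → ℝ} (hg : ContDiff ℝ 1 g) (hgs : HasCompactSupport g)
    {W : E → H} (hW : ContDiff ℝ 1 W) (x v : E) (s : ℝ) :
    s • ∫ y, g y • fderiv ℝ W (x + s • y) v ∂μ = -∫ y, fderiv ℝ g y v • W (x + s • y) ∂μ := by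
  have hWs : ContDiff ℝ 1 fun y => W (x + s • y) :=
    hW.comp (contDiff_const.add (contDiff_id.const_smul s))
  have hd : ∀ y, fderiv ℝ (fun y => W (x + s • y)) y v = s • fderiv ℝ W (x + s • y) v := by
    intro y
    have h1 : HasFDerivAt (fun y : E => x + s • y) (s • ContinuousLinearMap.id ℝ E) y :=
      ((hasFDerivAt_id y).const_smul s).const_add x
    have h2 := (hW.differentiable (by simp) (x + s • y)).hasFDerivAt.comp y h1
    have h3 : (fun y => W (x + s • y)) = W ∘ fun y => x + s • y := rfl
    rw [h3, h2.fderiv]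
    simp
  have hc1 : Continuous fun y => fderiv ℝ g y v := (hg.continuous_fderiv (by simp)).clm_apply
    continuous_const
  have hc2 : Continuous fun y => fderiv ℝ (fun y => W (x + s • y)) y v :=
    (hWs.continuous_fderiv (by simp)).clm_apply continuous_const
  have := integral_smul_fderiv_eq_neg_fderiv_smul_of_integrable (μ := μ) (f := g)
    (g := fun y => W (x + s • y)) (v := v)
    ((hc1.smul hWs.continuous).integrable_of_hasCompactSupport
      ((hgs.fderiv_apply (𝕜 := ℝ) v).smul_right))
    ((hg.continuous.smul hc2).integrable_of_hasCompactSupport hgs.smul_right)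
    ((hg.continuous.smul hWs.continuous).integrable_of_hasCompactSupport hgs.smul_right)
    (fun y _ => hg.differentiable (by simp) y) (fun y _ => hWs.differentiable (by simp) y)
  rw [← this, ← integral_smul]
  refine integral_congr_ae (Eventually.of_forall fun y => ?_)
  simp only [hd, smul_comm s]

/-- Integrate by parts: since `bump` is radial, the `j`-th derivative of `bump * coord i` is
symmetric in `i ≠ j`. -/
theorem integral_bump_smul_fderiv_comm {W : E → H} (hW : ContDiff ℝ 1 W) (x : E) (s : ℝ)
    (i j : ι) :
    ∫ y, (S.bump y * S.coord i y) • fderiv ℝ W (x + s • y) (S.vec j) ∂μ =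
      ∫ y, (S.bump y * S.coord j y) • fderiv ℝ W (x + s • y) (S.vec i) ∂μ := by
  rcases eq_or_ne i j with rfl | hij
  · rfl
  rcases eq_or_ne s 0 with rfl | hs
  -- Integration by parts carries the factor `s` and says nothing here; instead the integrand is
  -- odd.
  · have key : ∀ i j, ∫ y, (S.bump y * S.coord i y) • fderiv ℝ W (x + (0 : ℝ) • y) (S.vec j) ∂μ
        = 0 := by
      intro i j
      have h := integral_neg_eq_self
        (fun y => (S.bump y * S.coord i y) • fderiv ℝ W (x + (0 : ℝ) • y) (S.vec j)) μ
      simp only [S.bump_neg, map_neg, mul_neg, neg_smul, zero_smul, add_zero, integral_neg] at h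
      have h2 := add_eq_zero_iff_neg_eq.2 h
      rw [← two_smul ℝ] at h2
      simpa using h2
    rw [key, key]
  · have hd : ∀ i j : ι, i ≠ j → ∀ y, fderiv ℝ (fun y => S.bump y * S.coord i y) y (S.vec j) =
        deriv Real.smoothTransition (1 - ∑ i, S.coord i y ^ 2) *
          (-2 * (S.coord i y * S.coord j y)) := by
      intro i j hij y
      rw [fderiv_fun_mul ((S.contDiff_bump (n := 1)).differentiable (by simp) y)
        (S.coord i).differentiableAt]
      simp [S.fderiv_bump, S.coord_vec, hij]
      ring
    have hg : ∀ i : ι, ContDiff ℝ 1 fun y => S.bump y * S.coord i y := fun i =>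
      (S.contDiff_bump (n := 1)).mul (S.coord i).contDiff
    have hgs : ∀ i : ι, HasCompactSupport fun y => S.bump y * S.coord i y := fun i =>
      S.hasCompactSupport_bump.mul_right
    refine smul_right_injective _ hs ?_
    simp only
    rw [smul_integral_smul_fderiv μ (hg i) (hgs i) hW, smul_integral_smul_fderiv μ (hg j) (hgs j) hW]
    simp only [hd i j hij, hd j i hij.symm, mul_comm (S.coord i _)]

/-- This integral is the `s`-derivative of the weighted average of `W`. It is the trace of the
matrix `J i j`, which is symmetric by `integral_bump_smul_fderiv_comm`; symmetrising `∑ adj i (symb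
j (J i j)) = 0` with the Clifford relations leaves twice the trace. -/
theorem integral_bump_smul_fderiv_self_eq_zero [CompleteSpace H] {W : E → H}
    (hW : ContDiff ℝ 1 W) {x : E} {R s : ℝ}
    (hnull : ∀ z ∈ ball x R, S.dirac W z = 0) (hs : 0 ≤ s) (hsR : s ≤ R) (hR : 0 < R) :
    ∫ y, S.bump y • fderiv ℝ W (x + s • y) y ∂μ = 0 := by
  set J : ι → ι → H := fun i j =>
    ∫ y, (S.bump y * S.coord i y) • fderiv ℝ W (x + s • y) (S.vec j) ∂μ with hJ
  have hint : ∀ i j, Integrable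
      (fun y => (S.bump y * S.coord i y) • fderiv ℝ W (x + s • y) (S.vec j)) μ := by
    intro i j
    refine Continuous.integrable_of_hasCompactSupport ?_
      (S.hasCompactSupport_bump.mul_right).smul_right
    refine (S.continuous_bump.mul (S.coord i).continuous).smul ?_
    exact ((hW.continuous_fderiv (by simp)).comp (by fun_prop)).clm_apply continuous_const
  have h1 : ∫ y, S.bump y • fderiv ℝ W (x + s • y) y ∂μ = ∑ i, J i i := by
    rw [hJ, ← integral_finsetSum _ fun i _ => hint i i]
    refine integral_congr_ae (Eventually.of_forall fun y => ?_)
    simp only [mul_smul, ← Finset.smul_sum, ← map_smul, ← map_sum, S.sum_coord]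
  have h2 : ∑ i, ∑ j, S.adj i (S.symb j (J i j)) = 0 := by
    have h3 : ∀ i j, S.adj i (S.symb j (J i j)) = ∫ y, S.adj i (S.symb j
        ((S.bump y * S.coord i y) • fderiv ℝ W (x + s • y) (S.vec j))) ∂μ := fun i j =>
      (((S.adj i).comp (S.symb j)).integral_comp_comm (hint i j)).symm
    have hint2 : ∀ i j, Integrable (fun y => S.adj i (S.symb j
        ((S.bump y * S.coord i y) • fderiv ℝ W (x + s • y) (S.vec j)))) μ := fun i j =>
      ((S.adj i).comp (S.symb j)).integrable_comp (hint i j)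
    simp only [h3]
    simp only [← integral_finsetSum _ fun j _ => hint2 _ j]
    rw [← integral_finsetSum _ fun i _ => integrable_finsetSum _ fun j _ => hint2 i j]
    rw [← integral_zero E H (μ := μ)]
    refine integral_congr_ae (Eventually.of_forall fun y => ?_)
    simp only [map_smul, ← Finset.smul_sum, ← map_sum]
    rcases eq_or_ne (S.bump y) 0 with h0 | h0
    · simp [h0]
    · have hy := S.norm_lt_one_of_bump_ne_zero h0
      have hz : x + s • y ∈ ball x R := by
        rw [mem_ball, dist_self_add_left, norm_smul, Real.norm_of_nonneg hs]
        nlinarith [norm_nonneg y]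
      have := hnull _ hz
      rw [dirac] at this
      simp [this]
  have h4 : (2 : ℝ) • ∑ i, J i i = 0 := by
    calc (2 : ℝ) • ∑ i, J i i
        = ∑ i, ∑ j, (S.adj i (S.symb j (J i j)) + S.adj j (S.symb i (J i j))) := by
          simp [S.clifford, Finset.smul_sum]
      _ = ∑ i, ∑ j, S.adj i (S.symb j (J i j)) + ∑ i, ∑ j, S.adj j (S.symb i (J j i)) := by
          simp only [Finset.sum_add_distrib]
          congr 1
          refine Finset.sum_congr rfl fun i _ => Finset.sum_congr rfl fun j _ => ?_
          rw [show J i j = J j i from integral_bump_smul_fderiv_comm μ hW x s i j]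
      _ = 0 := by rw [Finset.sum_comm (f := fun i j => S.adj j (S.symb i (J j i))), h2, add_zero]
  rw [h1]
  simpa using h4

/-- The mean value property. -/
theorem integral_bump_smul_eq [CompleteSpace H] {W : E → H}
    (hW : ContDiff ℝ 1 W) (hWs : HasCompactSupport W) {x : E} {R : ℝ} (hR : 0 < R)
    (hnull : ∀ z ∈ ball x R, S.dirac W z = 0) :
    ∫ y, S.bump y • W (x + R • y) ∂μ = (∫ y, S.bump y ∂μ) • W x := by
  obtain ⟨C, hC⟩ := (hWs.fderiv (𝕜 := ℝ)).exists_bound_of_continuous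
    (hW.continuous_fderiv (by simp))
  have hcont : ∀ s : ℝ, Continuous fun y => S.bump y • W (x + s • y) := fun s =>
    S.continuous_bump.smul (hW.continuous.comp (by fun_prop))
  have hd : ∀ s : ℝ, HasDerivAt (fun s : ℝ => ∫ y, S.bump y • W (x + s • y) ∂μ)
      (∫ y, S.bump y • fderiv ℝ W (x + s • y) y ∂μ) s := by
    intro s
    refine (hasDerivAt_integral_of_dominated_loc_of_deriv_le (s := univ)
      (F := fun (s : ℝ) y => S.bump y • W (x + s • y))
      (F' := fun (s : ℝ) y => S.bump y • fderiv ℝ W (x + s • y) y)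
      (bound := fun y => S.bump y * C) univ_mem
      (Eventually.of_forall fun s => (hcont s).aestronglyMeasurable)
      ((hcont s).integrable_of_hasCompactSupport S.hasCompactSupport_bump.smul_right)
      (Continuous.aestronglyMeasurable ?_) (Eventually.of_forall fun y t _ => ?_)
      ((S.continuous_bump.integrable_of_hasCompactSupport S.hasCompactSupport_bump).mul_const C)
      (Eventually.of_forall fun y t _ => ?_)).2
    · exact S.continuous_bump.smul (((hW.continuous_fderiv (by simp)).comp
        (by fun_prop)).clm_apply continuous_id)
    · rcases eq_or_ne (S.bump y) 0 with h0 | h0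
      · simp [h0]
      · rw [norm_smul, Real.norm_of_nonneg (S.bump_nonneg y)]
        refine mul_le_mul_of_nonneg_left ?_ (S.bump_nonneg y)
        refine (ContinuousLinearMap.le_opNorm _ _).trans ?_
        have := S.norm_lt_one_of_bump_ne_zero h0
        nlinarith [hC (x + t • y), norm_nonneg (fderiv ℝ W (x + t • y)), norm_nonneg y]
    · have h1 : HasDerivAt (fun t : ℝ => x + t • y) y t := by
        simpa using ((hasDerivAt_id t).smul_const y).const_add x
      exact ((hW.differentiable (by simp) _).hasFDerivAt.comp_hasDerivAt t h1).const_smul _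
  -- The average at scale `R` equals the one at scale `0`, where `W` is evaluated only at `x`.
  have hconst := constant_of_has_deriv_right_zero (a := 0) (b := R)
    (f := fun s : ℝ => ∫ y, S.bump y • W (x + s • y) ∂μ)
    (fun s _ => (hd s).continuousAt.continuousWithinAt)
    (fun s hs => by
      have := (hd s).hasDerivWithinAt (s := Ici s)
      rwa [integral_bump_smul_fderiv_self_eq_zero μ hW hnull hs.1 hs.2.le hR] at this)
    R ⟨hR.le, le_rfl⟩
  rw [hconst]
  simp [integral_smul_const]

end DiracFrame

/-! ### Regularity, gradient estimates and local unique continuation. -/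

/-- Multiplication by a bump function reduces local questions to globally defined functions, as the
integral estimates require. -/
theorem exists_contDiff_hasCompactSupport_eqOn_ball {E H : Type*} [NormedAddCommGroup E]
    [NormedSpace ℝ E] [FiniteDimensional ℝ E] [NormedAddCommGroup H] [NormedSpace ℝ H]
    {n : ℕ∞} {u : E → H} {c : E} {r r' : ℝ}
    (hu : ContDiffOn ℝ n u (ball c r)) (hr' : 0 < r') (hr : r' < r) :
    ∃ w : E → H, ContDiff ℝ n w ∧ HasCompactSupport w ∧ EqOn w u (ball c r') := by
  let f : ContDiffBump c := ⟨r', (r' + r) / 2, hr', by linarith⟩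
  refine ⟨fun z => f z • u z, ?_, f.hasCompactSupport.smul_right, fun z hz => ?_⟩
  · refine contDiff_iff_contDiffAt.2 fun z => ?_
    by_cases hz : z ∈ ball c r
    · exact f.contDiffAt.smul (hu.contDiffAt (isOpen_ball.mem_nhds hz))
    · have hz' : z ∈ (closedBall c ((r' + r) / 2))ᶜ := by
        simp only [mem_ball, not_lt, mem_compl_iff, mem_closedBall, not_le] at hz ⊢
        linarith
      have : (fun z => f z • u z) =ᶠ[𝓝 z] fun _ => 0 := by
        filter_upwards [isClosed_closedBall.isOpen_compl.mem_nhds hz'] with y hy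
        have hy' : ¬dist y c ≤ (r' + r) / 2 := hy
        rw [f.zero_of_le_dist (not_le.1 hy').le, zero_smul]
      exact contDiffAt_const.congr_of_eventuallyEq this
  · simp only
    rw [f.one_of_mem_closedBall (ball_subset_closedBall hz), one_smul]

/-- Taylor's estimate at a point where all derivatives vanish: the bound on `g k` is integrated `k`
times. -/
theorem norm_le_pow_div_factorial {H : Type*} [NormedAddCommGroup H] [NormedSpace ℝ H] {B : ℝ}
    (k : ℕ) (g : ℕ → ℝ → H) (hg : ∀ j t, HasDerivAt (g j) (g (j + 1) t) t)
    (h0 : ∀ j, g j 0 = 0) (hB : ∀ t ∈ Icc (0 : ℝ) 1, ‖g k t‖ ≤ B) :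
    ∀ t ∈ Icc (0 : ℝ) 1, ‖g 0 t‖ ≤ B * (t ^ k / k.factorial) := by
  induction k generalizing g with
  | zero => simpa using hB
  | succ k ih =>
    have h1 := ih (fun j => g (j + 1)) (fun j t => hg (j + 1) t) (fun j => h0 (j + 1)) hB
    intro t ht
    refine image_norm_le_of_norm_deriv_right_le_deriv_boundary (f' := g 1)
      (B := fun t => B * (t ^ (k + 1) / (k + 1).factorial)) (B' := fun t => B * (t ^ k / k.factorial))
      (fun t _ => (hg 0 t).continuousAt.continuousWithinAt)
      (fun t _ => (hg 0 t).hasDerivWithinAt) (by simp [h0]) (fun t => ?_)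
      (fun t ht => h1 t ⟨ht.1, ht.2.le⟩) ht
    have := ((hasDerivAt_pow (k + 1) t).div_const ((k + 1).factorial : ℝ)).const_mul B
    refine this.congr_deriv ?_
    rw [Nat.factorial_succ]
    push_cast
    have : (k.factorial : ℝ) ≠ 0 := by positivity
    have : (k : ℝ) + 1 ≠ 0 := by positivity
    field_simp

namespace DiracFrame

variable {ι E H : Type*} [Fintype ι] [DecidableEq ι] [NormedAddCommGroup E]
    [NormedSpace ℝ E] [NormedAddCommGroup H] [NormedSpace ℝ H] {S : DiracFrame ι E H}

theorem dirac_congr {u w : E → H} {z : E} (h : u =ᶠ[𝓝 z] w) : S.dirac u z = S.dirac w z := by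
  simp only [dirac, h.fderiv_eq]

theorem fderiv_bump_eq_zero {y : E} (h : S.bump y = 0) : fderiv ℝ S.bump y = 0 :=
  IsLocalMin.fderiv_eq_zero (Eventually.of_forall fun z => h ▸ S.bump_nonneg z)

theorem contDiff_fderiv_apply {W : E → H} (hW : ContDiff ℝ (⊤ : ℕ∞) W) (v : E) :
    ContDiff ℝ (⊤ : ℕ∞) fun z => fderiv ℝ W z v :=
  (hW.fderiv_right (by simp)).clm_apply contDiff_const

/-- Directional derivatives commute with the operator. -/
theorem dirac_fderiv_apply {W : E → H} (hW : ContDiff ℝ (⊤ : ℕ∞) W) (v : E) {U : Set E}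
    (hU : IsOpen U) (hnull : ∀ z ∈ U, S.dirac W z = 0) :
    ∀ z ∈ U, S.dirac (fun z => fderiv ℝ W z v) z = 0 := by
  intro z hz
  have hd : ∀ v z, HasFDerivAt (fun z => fderiv ℝ W z v) (fderiv ℝ (fun z => fderiv ℝ W z v) z) z :=
    fun v z => ((contDiff_fderiv_apply hW v).differentiable (by simp) z).hasFDerivAt
  have hd2 : HasFDerivAt (fderiv ℝ W) (fderiv ℝ (fderiv ℝ W) z) z :=
    ((hW.fderiv_right (m := (⊤ : ℕ∞)) (by simp)).differentiable (by simp) z).hasFDerivAt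
  have happ : ∀ v w, fderiv ℝ (fun z => fderiv ℝ W z v) z w = fderiv ℝ (fderiv ℝ W) z w v := by
    intro v w
    have := (hd2.clm_apply (hasFDerivAt_const v z)).fderiv
    rw [this]
    simp
  have hsymm : ∀ v w, fderiv ℝ (fderiv ℝ W) z v w = fderiv ℝ (fderiv ℝ W) z w v := fun v w =>
    (hW.contDiffAt.isSymmSndFDerivAt (by
      rw [minSmoothness_of_isRCLikeNormedField]
      exact WithTop.coe_le_coe.2 (le_top (a := (2 : ℕ∞))))) v w
  have h1 : HasFDerivAt (S.dirac W)
      (∑ i, (S.symb i).comp (fderiv ℝ (fun z => fderiv ℝ W z (S.vec i)) z)) z :=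
    HasFDerivAt.fun_sum fun i _ => (S.symb i).hasFDerivAt.comp z (hd _ z)
  have h2 : HasFDerivAt (S.dirac W) (0 : E →L[ℝ] H) z :=
    (hasFDerivAt_const (0 : H) z).congr_of_eventuallyEq
      (by filter_upwards [hU.mem_nhds hz] with y hy using hnull y hy)
  have h3 := DFunLike.congr_fun (h1.unique h2) v
  simp only [_root_.sum_apply, ContinuousLinearMap.comp_apply,
    _root_.zero_apply, happ] at h3
  simpa only [dirac, happ, hsymm v] using h3

variable [FiniteDimensional ℝ E] [MeasurableSpace E] [BorelSpace E] (μ : Measure E)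
  [μ.IsAddHaarMeasure]

/-- Up to rescaling, the average is a convolution with the even function `bump`, which supplies all
the smoothness. -/
theorem contDiff_integral_bump_smul {n : ℕ∞} {W : E → H} (hW : Continuous W) {s : ℝ}
    (hs : s ≠ 0) : ContDiff ℝ n fun x => ∫ y, S.bump y • W (x + s • y) ∂μ := by
  have h1 : ContDiff ℝ n (convolution S.bump (fun y => W (s • y)) (ContinuousLinearMap.lsmul ℝ ℝ) μ) :=
    S.hasCompactSupport_bump.contDiff_convolution_left _ S.contDiff_bump
      ((hW.comp (continuous_const_smul s)).locallyIntegrable)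
  have h2 : (fun x => ∫ y, S.bump y • W (x + s • y) ∂μ) = fun x =>
      convolution S.bump (fun y => W (s • y)) (ContinuousLinearMap.lsmul ℝ ℝ) μ (s⁻¹ • x) := by
    ext x
    rw [convolution_def, ← integral_neg_eq_self]
    simp [S.bump_neg, smul_smul, hs, sub_eq_add_neg]
  rw [h2]
  exact h1.comp (contDiff_const_smul s⁻¹)

variable (S) in
/-- The constant in the gradient estimate. -/
noncomputable def gradConst : ℝ := (∫ y, ‖fderiv ℝ S.bump y‖ ∂μ) / ∫ y, S.bump y ∂μ

theorem gradConst_nonneg : 0 ≤ S.gradConst μ :=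
  div_nonneg (integral_nonneg fun _ => norm_nonneg _) (S.integral_bump_pos μ).le

variable (S) in
/-- The ratio of the radii in the local unique continuation property. -/
noncomputable def contConst : ℝ := 2 + 2 * S.gradConst μ * Real.exp 1

theorem two_le_contConst : 2 ≤ S.contConst μ := by
  have := S.gradConst_nonneg μ
  rw [contConst]
  have : 0 ≤ 2 * S.gradConst μ * Real.exp 1 := by positivity
  linarith

variable [CompleteSpace H]

/-- Null solutions of class `C¹` are smooth. -/
theorem contDiffOn_ball {W : E → H} (hW : ContDiff ℝ 1 W) (hWs : HasCompactSupport W) {c : E}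
    {R : ℝ} (hnull : ∀ z ∈ ball c R, S.dirac W z = 0) {n : ℕ∞} :
    ContDiffOn ℝ n W (ball c R) := by
  intro x hx
  rw [mem_ball] at hx
  refine ContDiffAt.contDiffWithinAt ?_
  let μ : Measure E := Measure.addHaar
  -- Half the distance to the sphere, so that `ball z s` stays in `ball c R` for every `z` within
  -- `s` of `x`.
  set s := (R - dist x c) / 2 with hs
  have hs0 : 0 < s := by linarith
  have h1 := (contDiff_integral_bump_smul (S := S) μ hW.continuous hs0.ne' (n := n)).const_smul
    (∫ y, S.bump y ∂μ)⁻¹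
  refine h1.contDiffAt.congr_of_eventuallyEq ?_
  filter_upwards [ball_mem_nhds x hs0] with z hz
  rw [integral_bump_smul_eq μ hW hWs hs0, inv_smul_smul₀ (S.integral_bump_pos μ).ne']
  intro y hy
  refine hnull y ?_
  rw [mem_ball] at hz hy ⊢
  linarith [dist_triangle y z c, dist_triangle z x c]

/-- The interior gradient estimate. -/
theorem norm_fderiv_apply_le {W : E → H} (hW : ContDiff ℝ (⊤ : ℕ∞) W)
    (hWs : HasCompactSupport W) {x : E} {R M : ℝ} (hR : 0 < R)
    (hnull : ∀ z ∈ ball x R, S.dirac W z = 0) (hM : ∀ z ∈ ball x R, ‖W z‖ ≤ M) (v : E) :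
    ‖fderiv ℝ W x v‖ ≤ S.gradConst μ * ‖v‖ / R * M := by
  have hW1 : ContDiff ℝ 1 W := hW.of_le (by exact_mod_cast le_top)
  -- The derivative along `v` is itself a null solution, hence equals its average; integration by
  -- parts then moves the derivative onto `bump`, at the price of `1 / R`.
  have h1 := integral_bump_smul_eq μ ((contDiff_fderiv_apply hW v).of_le (by exact_mod_cast le_top))
    (hWs.fderiv_apply (𝕜 := ℝ) v) hR (dirac_fderiv_apply hW v isOpen_ball hnull)
  have h2 := smul_integral_smul_fderiv μ (S.contDiff_bump (n := 1)) S.hasCompactSupport_bump hW1 x v R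
  rw [h1] at h2
  have hI := S.integral_bump_pos μ
  have h3 : ‖∫ y, fderiv ℝ S.bump y v • W (x + R • y) ∂μ‖ ≤
      ∫ y, ‖fderiv ℝ S.bump y‖ * (‖v‖ * M) ∂μ := by
    refine norm_integral_le_of_norm_le ?_ (Eventually.of_forall fun y => ?_)
    · refine Integrable.mul_const ?_ _
      exact (((S.contDiff_bump (n := 1)).continuous_fderiv (by simp)).norm).integrable_of_hasCompactSupport
        (S.hasCompactSupport_bump.fderiv (𝕜 := ℝ)).norm
    · rcases eq_or_ne (S.bump y) 0 with h0 | h0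
      · simp [fderiv_bump_eq_zero h0]
      · have hy := S.norm_lt_one_of_bump_ne_zero h0
        have hz : x + R • y ∈ ball x R := by
          rw [mem_ball, dist_self_add_left, norm_smul, Real.norm_of_nonneg hR.le]
          nlinarith [norm_nonneg y]
        rw [norm_smul, ← mul_assoc]
        exact mul_le_mul (ContinuousLinearMap.le_opNorm _ _) (hM _ hz) (norm_nonneg _)
          (by positivity)
  rw [← norm_neg, ← h2, norm_smul, norm_smul, Real.norm_of_nonneg hR.le,
    Real.norm_of_nonneg hI.le, integral_mul_const] at h3
  rw [gradConst]
  have h4 : (∫ y, ‖fderiv ℝ S.bump y‖ ∂μ) / (∫ y, S.bump y ∂μ) * ‖v‖ / R * M =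
      ((∫ y, ‖fderiv ℝ S.bump y‖ ∂μ) * (‖v‖ * M)) / (R * ∫ y, S.bump y ∂μ) := by
    field_simp
  rw [h4, le_div_iff₀ (by positivity)]
  linarith

/-- Each derivative costs `δ` of the radius and one factor from the gradient estimate on balls of
radius `δ`. -/
theorem norm_iterate_fderiv_apply_le (v : E) {δ : ℝ} (hδ : 0 < δ) (c : E) (j : ℕ) {W : E → H}
    (hW : ContDiff ℝ (⊤ : ℕ∞) W) (hWs : HasCompactSupport W) {R M : ℝ}
    (hnull : ∀ z ∈ ball c R, S.dirac W z = 0) (hM : ∀ z ∈ ball c R, ‖W z‖ ≤ M) :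
    ∀ z ∈ ball c (R - j * δ), ‖(fun (w : E → H) z => fderiv ℝ w z v)^[j] W z‖ ≤
      (S.gradConst μ * ‖v‖ / δ) ^ j * M := by
  induction j generalizing W R M with
  | zero => simpa using hM
  | succ j ih =>
    intro z hz
    have hsub : ball c (R - δ) ⊆ ball c R := ball_subset_ball (by linarith)
    have := ih (contDiff_fderiv_apply hW v) (hWs.fderiv_apply (𝕜 := ℝ) v) (R := R - δ)
      (M := S.gradConst μ * ‖v‖ / δ * M)
      (fun z hz => dirac_fderiv_apply hW v isOpen_ball hnull z (hsub hz))
      (fun z hz => by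
        have hsub' : ball z δ ⊆ ball c R := ball_subset_ball' (by
          rw [mem_ball] at hz; linarith)
        exact norm_fderiv_apply_le μ hW hWs hδ (fun y hy => hnull y (hsub' hy))
          (fun y hy => hM y (hsub' hy)) v)
      z (by convert hz using 2; push_cast; ring)
    rw [Function.iterate_succ_apply]
    refine this.trans_eq ?_
    ring

/-- A smooth null solution on a ball which vanishes near the centre vanishes on a smaller ball
whose radius is a fixed proportion of the radius. -/
theorem eq_zero_of_eventuallyEq_zero {W : E → H} (hW : ContDiff ℝ (⊤ : ℕ∞) W)
    (hWs : HasCompactSupport W) {c : E} {R : ℝ} (hR : 0 < R)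
    (hnull : ∀ z ∈ ball c R, S.dirac W z = 0) (h0 : W =ᶠ[𝓝 c] 0) :
    ∀ x ∈ ball c (R / S.contConst μ), W x = 0 := by
  intro x hx
  obtain ⟨M, hM⟩ := hWs.exists_bound_of_continuous hW.continuous
  have hM0 : 0 ≤ M := (norm_nonneg _).trans (hM c)
  have hA := S.two_le_contConst μ
  have hK := S.gradConst_nonneg μ
  set v := x - c with hv
  -- The summand `2` of `contConst` keeps the segment from `c` to `x` in the half ball; the other
  -- summand gives `q < 1` below.
  have hvR : ‖v‖ * S.contConst μ < R := by
    rwa [mem_ball, dist_eq_norm, lt_div_iff₀ (by linarith)] at hx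
  set g : ℕ → ℝ → H := fun j t => (fun (w : E → H) z => fderiv ℝ w z v)^[j] W (c + t • v) with hg
  have hsm : ∀ j, ContDiff ℝ (⊤ : ℕ∞) ((fun (w : E → H) z => fderiv ℝ w z v)^[j] W) := by
    intro j
    induction j with
    | zero => exact hW
    | succ j ih => rw [Function.iterate_succ_apply']; exact contDiff_fderiv_apply ih v
  have hz : ∀ j, (fun (w : E → H) z => fderiv ℝ w z v)^[j] W =ᶠ[𝓝 c] 0 := by
    intro j
    induction j with
    | zero => exact h0
    | succ j ih =>
      rw [Function.iterate_succ_apply']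
      filter_upwards [ih.fderiv (𝕜 := ℝ)] with z hz
      simp only [hz]
      simp
  have hgd : ∀ j t, HasDerivAt (g j) (g (j + 1) t) t := by
    intro j t
    have h1 : HasDerivAt (fun t : ℝ => c + t • v) v t := by
      simpa using ((hasDerivAt_id t).smul_const v).const_add c
    have := ((hsm j).differentiable (by simp) (c + t • v)).hasFDerivAt.comp_hasDerivAt t h1
    simp only [hg, Function.iterate_succ_apply']
    exact this
  have hg0 : ∀ j, g j 0 = 0 := by
    intro j
    have := (hz j).eq_of_nhds
    simpa [hg] using this
  set q := 2 * S.gradConst μ * Real.exp 1 * ‖v‖ / R with hq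
  have hq0 : 0 ≤ q := by positivity
  have hq1 : q < 1 := by
    rw [hq, div_lt_one hR]
    rw [contConst] at hvR
    nlinarith [norm_nonneg v]
  have key : ∀ k : ℕ, ‖W x‖ ≤ q ^ (k + 1) * M := by
    intro k
    -- Then `k + 1` derivatives use up exactly half the radius. The resulting `(k + 1) ^ (k + 1)` is
    -- absorbed by the factorial in Taylor's estimate, leaving a power of `e`.
    have hδ : 0 < R / (2 * ((k + 1 : ℕ) : ℝ)) := by positivity
    have hb := norm_iterate_fderiv_apply_le μ v hδ c (k + 1) hW hWs hnull (fun z _ => hM z)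
    have h1 := norm_le_pow_div_factorial (k + 1) g hgd hg0 (fun t ht => hb _ (by
      have hk : R - ((k + 1 : ℕ) : ℝ) * (R / (2 * ((k + 1 : ℕ) : ℝ))) = R / 2 := by
        have : ((k + 1 : ℕ) : ℝ) ≠ 0 := by positivity
        field_simp
        ring
      rw [hk, mem_ball, dist_self_add_left, norm_smul, Real.norm_of_nonneg ht.1]
      nlinarith [norm_nonneg v, ht.2])) 1 ⟨zero_le_one, le_rfl⟩
    have hg1 : g 0 1 = W x := by simp [hg, hv]
    rw [hg1] at h1
    refine h1.trans ?_
    have h2 : (((k + 1 : ℕ) : ℝ) ^ (k + 1)) / ((k + 1).factorial : ℝ) ≤ Real.exp 1 ^ (k + 1) := by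
      rw [← Real.exp_nat_mul, mul_one]
      exact Real.pow_div_factorial_le_exp _ (by positivity) _
    calc (S.gradConst μ * ‖v‖ / (R / (2 * ((k + 1 : ℕ) : ℝ)))) ^ (k + 1) * M *
          (1 ^ (k + 1) / ((k + 1).factorial : ℝ))
        = (2 * S.gradConst μ * ‖v‖ / R) ^ (k + 1) * M *
          ((((k + 1 : ℕ) : ℝ) ^ (k + 1)) / ((k + 1).factorial : ℝ)) := by
          rw [one_pow, show S.gradConst μ * ‖v‖ / (R / (2 * ((k + 1 : ℕ) : ℝ))) =
            (2 * S.gradConst μ * ‖v‖ / R) * ((k + 1 : ℕ) : ℝ) by field_simp, mul_pow]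
          ring
      _ ≤ (2 * S.gradConst μ * ‖v‖ / R) ^ (k + 1) * M * Real.exp 1 ^ (k + 1) := by gcongr
      _ = q ^ (k + 1) * M := by
          rw [hq, show 2 * S.gradConst μ * Real.exp 1 * ‖v‖ / R =
            (2 * S.gradConst μ * ‖v‖ / R) * Real.exp 1 by ring, mul_pow]
          ring
  have hlim : Tendsto (fun k : ℕ => q ^ (k + 1) * M) atTop (𝓝 0) := by
    simpa using ((tendsto_add_atTop_iff_nat 1).2
      (tendsto_pow_atTop_nhds_zero_of_lt_one hq0 hq1)).mul_const M
  exact norm_le_zero_iff.1 (ge_of_tendsto' hlim key)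

end DiracFrame

/-! ### Identity theorems on connected open sets. -/

namespace DiracFrame

variable {ι E H : Type*} [Fintype ι] [DecidableEq ι] [NormedAddCommGroup E]
    [NormedSpace ℝ E] [NormedAddCommGroup H] [NormedSpace ℝ H] {S : DiracFrame ι E H}
    [FiniteDimensional ℝ E] [CompleteSpace H]

/-- The identity theorem for null solutions on a connected open set. -/
theorem eqOn_zero_of_eventuallyEq_zero {U : Set E} (hU : IsOpen U) (hUc : IsPreconnected U)
    {u : E → H} (hu : ContDiffOn ℝ 1 u U) (hnull : ∀ z ∈ U, S.dirac u z = 0) {z₀ : E}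
    (hz₀ : z₀ ∈ U) (h0 : u =ᶠ[𝓝 z₀] 0) : ∀ z ∈ U, u z = 0 := by
  borelize E
  let μ : Measure E := Measure.addHaar
  have hsub : U ⊆ {z | ∀ᶠ y in 𝓝 z, u y = 0} := by
    refine hUc.subset_of_closure_inter_subset isOpen_setOfPred_eventually_nhds ⟨z₀, hz₀, h0⟩ ?_
    rintro c ⟨hc, hcU⟩
    obtain ⟨r, hr, hrU⟩ := Metric.isOpen_iff.1 hU c hcU
    -- Two cutoffs are needed: the first makes the mean value property available, which gives
    -- smoothness; the second yields a global smooth function.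
    obtain ⟨w₁, hw₁, hw₁s, hw₁u⟩ := exists_contDiff_hasCompactSupport_eqOn_ball (n := 1)
      (hu.mono hrU) (r' := r / 2) (by linarith) (by linarith)
    have hnull₁ : ∀ z ∈ ball c (r / 2), S.dirac w₁ z = 0 := fun z hz => by
      rw [dirac_congr (hw₁u.eventuallyEq_of_mem (isOpen_ball.mem_nhds hz))]
      exact hnull z (hrU (ball_subset_ball (by linarith) hz))
    obtain ⟨w, hw, hws, hww⟩ := exists_contDiff_hasCompactSupport_eqOn_ball (n := ⊤)
      (contDiffOn_ball hw₁ hw₁s hnull₁) (r' := r / 4) (by linarith) (by linarith)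
    have hwu : EqOn w u (ball c (r / 4)) :=
      hww.trans (hw₁u.mono (ball_subset_ball (by linarith)))
    have hA := S.two_le_contConst μ
    -- The radius of vanishing around a nearby `c'` does not depend on `c'`, so `c'` can be chosen
    -- close enough for it to cover `c`.
    have hρ : 0 < r / 8 / S.contConst μ := by positivity
    have hρ' : r / 8 / S.contConst μ ≤ r / 8 := div_le_self (by linarith) (by linarith)
    obtain ⟨c', hc', hcc'⟩ := Metric.mem_closure_iff.1 hc _ hρ
    have hball : ball c' (r / 8) ⊆ ball c (r / 4) := ball_subset_ball' (by
      rw [dist_comm] at hcc'; linarith)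
    have hnull' : ∀ z ∈ ball c' (r / 8), S.dirac w z = 0 := fun z hz => by
      rw [dirac_congr (hww.eventuallyEq_of_mem (isOpen_ball.mem_nhds (hball hz)))]
      exact hnull₁ z (ball_subset_ball (by linarith) (hball hz))
    have hw0 : w =ᶠ[𝓝 c'] 0 := by
      have h1 := hwu.eventuallyEq_of_mem (isOpen_ball.mem_nhds
        (hball (mem_ball_self (by linarith : 0 < r / 8))))
      exact h1.trans hc'
    have hfin := eq_zero_of_eventuallyEq_zero μ hw hws (by linarith) hnull' hw0
    filter_upwards [isOpen_ball.mem_nhds (show c ∈ ball c' (r / 8 / S.contConst μ) from hcc')]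
      with y hy
    rw [← hwu (hball (ball_subset_ball hρ' hy))]
    exact hfin y hy
  exact fun z hz => (hsub hz).self_of_nhds

/-- The identity theorem for null solutions which vanish on a coordinate hyperplane. -/
theorem eqOn_zero_of_eqOn_hyperplane {U : Set E} (hU : IsOpen U) (hUc : IsPreconnected U)
    {u : E → H} (hu : ContDiffOn ℝ 1 u U) (hnull : ∀ z ∈ U, S.dirac u z = 0) (i : ι) {z₀ : E}
    (hz₀ : z₀ ∈ U) (hz₀i : S.coord i z₀ = 0) (h0 : ∀ z ∈ U, S.coord i z = 0 → u z = 0) :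
    ∀ z ∈ U, u z = 0 := by
  have hd : ∀ z ∈ U, HasFDerivAt u (fderiv ℝ u z) z := fun z hz =>
    ((hu.contDiffAt (hU.mem_nhds hz)).differentiableAt (by simp)).hasFDerivAt
  have hline : ∀ z v : E, Tendsto (fun t : ℝ => z + t • v) (𝓝 0) (𝓝 z) := by
    intro z v
    have : Continuous fun t : ℝ => z + t • v := by fun_prop
    simpa using this.tendsto 0
  -- Tangential derivatives vanish with `u`; the equation then kills the normal one, since `symb i`
  -- is injective by the Clifford relation.
  have hd0 : ∀ z ∈ U, S.coord i z = 0 → fderiv ℝ u z = 0 := by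
    intro z hz hzi
    have hj : ∀ j, j ≠ i → fderiv ℝ u z (S.vec j) = 0 := by
      intro j hji
      have h1 := (hd z hz).hasLineDerivAt (S.vec j)
      have h2 : HasDerivAt (fun t : ℝ => u (z + t • S.vec j)) 0 0 := by
        refine (hasDerivAt_const (0 : ℝ) (0 : H)).congr_of_eventuallyEq ?_
        filter_upwards [(hline z (S.vec j)).eventually (hU.mem_nhds hz)] with t ht
        exact h0 _ ht (by simp [hzi, S.coord_vec, hji.symm])
      exact HasDerivAt.unique h1 h2
    have hi : fderiv ℝ u z (S.vec i) = 0 := by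
      have h1 := hnull z hz
      rw [dirac, Finset.sum_eq_single i (fun j _ hji => by rw [hj j hji, map_zero])
        (by simp)] at h1
      have h2 := S.clifford i i (fderiv ℝ u z (S.vec i))
      rw [h1] at h2
      simpa using h2.symm
    ext v
    rw [← S.sum_coord v, map_sum]
    refine Finset.sum_eq_zero fun j _ => ?_
    rw [map_smul]
    rcases eq_or_ne j i with rfl | hji
    · rw [hi, smul_zero]
    · rw [hj j hji, smul_zero]
  -- As `u` and its derivative vanish on the hyperplane, this truncation is still a `C¹` null
  -- solution. It is zero on an open set, hence on `U`, so `u` is zero on the positive side.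
  set u' : E → H := fun z => if 0 < S.coord i z then u z else 0 with hu'
  have hpos : ∀ z, 0 < S.coord i z → u' =ᶠ[𝓝 z] u := by
    intro z hz
    filter_upwards [(isOpen_lt continuous_const (S.coord i).continuous).mem_nhds hz] with y hy
    exact if_pos hy
  have hneg : ∀ z, S.coord i z < 0 → u' =ᶠ[𝓝 z] 0 := by
    intro z hz
    filter_upwards [(isOpen_lt (S.coord i).continuous continuous_const).mem_nhds hz] with y hy
    exact if_neg (not_lt.2 (le_of_lt hy))
  have hle : ∀ z, ‖u' z‖ ≤ ‖u z‖ := by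
    intro z
    simp only [hu']
    split_ifs <;> simp
  have hd' : ∀ z ∈ U, HasFDerivAt u' (if 0 < S.coord i z then fderiv ℝ u z else 0) z := by
    intro z hz
    rcases lt_trichotomy (S.coord i z) 0 with h | h | h
    · rw [if_neg h.not_gt]
      exact (hasFDerivAt_const (0 : H) z).congr_of_eventuallyEq (hneg z h)
    · rw [if_neg h.not_gt]
      have h1 := hd z hz
      rw [hd0 z hz h, hasFDerivAt_iff_isLittleO] at h1
      rw [hasFDerivAt_iff_isLittleO]
      have h2 : u' z = 0 := if_neg h.not_gt
      refine Asymptotics.IsBigO.trans_isLittleO (Asymptotics.isBigO_of_le _ fun y => ?_) h1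
      simpa [h2, h0 z hz h] using hle y
    · rw [if_pos h]
      exact (hd z hz).congr_of_eventuallyEq (hpos z h)
  have hcont : ContinuousOn (fderiv ℝ u) U := hu.continuousOn_fderiv_of_isOpen hU le_rfl
  have hu'1 : ContDiffOn ℝ 1 u' U := by
    rw [show (1 : WithTop ℕ∞) = 0 + 1 by simp, contDiffOn_succ_iff_fderiv_of_isOpen hU,
      contDiffOn_zero]
    refine ⟨fun z hz => (hd' z hz).differentiableAt.differentiableWithinAt, by simp, ?_⟩
    have : ContinuousOn (fun z => if 0 < S.coord i z then fderiv ℝ u z else 0) U := by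
      intro z hz
      rcases lt_trichotomy (S.coord i z) 0 with h | h | h
      · refine (continuousAt_const (y := 0)).continuousWithinAt.congr_of_eventuallyEq ?_ (if_neg h.not_gt)
        filter_upwards [mem_nhdsWithin_of_mem_nhds
          ((isOpen_lt (S.coord i).continuous continuous_const).mem_nhds h)] with y hy
        exact if_neg (not_lt.2 (le_of_lt hy))
      · have h1 := hcont z hz
        rw [ContinuousWithinAt, hd0 z hz h, tendsto_zero_iff_norm_tendsto_zero] at h1
        rw [ContinuousWithinAt, if_neg h.not_gt, tendsto_zero_iff_norm_tendsto_zero]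
        refine squeeze_zero (fun _ => norm_nonneg _) (fun y => ?_) h1
        split_ifs <;> simp
      · refine (hcont z hz).congr_of_eventuallyEq ?_ (if_pos h)
        filter_upwards [mem_nhdsWithin_of_mem_nhds
          ((isOpen_lt continuous_const (S.coord i).continuous).mem_nhds h)] with y hy
        exact if_pos hy
    exact this.congr fun z hz => (hd' z hz).fderiv
  have hnull' : ∀ z ∈ U, S.dirac u' z = 0 := by
    intro z hz
    rw [dirac, (hd' z hz).fderiv]
    split_ifs
    · exact hnull z hz
    · simp
  obtain ⟨t, ht, htU⟩ : ∃ t : ℝ, 0 < t ∧ z₀ + t • S.vec i ∈ U ∧ z₀ + (-t) • S.vec i ∈ U := by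
    have h1 := (hline z₀ (S.vec i)).eventually (hU.mem_nhds hz₀)
    have h2 := (hline z₀ (-S.vec i)).eventually (hU.mem_nhds hz₀)
    obtain ⟨t, ht, ht0⟩ := (((h1.and h2).filter_mono nhdsWithin_le_nhds).and
      (self_mem_nhdsWithin (s := Ioi (0 : ℝ)))).exists
    refine ⟨t, ht0, ht.1, ?_⟩
    rw [neg_smul, ← smul_neg]
    exact ht.2
  have hz' := eqOn_zero_of_eventuallyEq_zero hU hUc hu'1 hnull' htU.2
    (hneg _ (by simp [hz₀i, S.coord_vec, ht]))
  refine eqOn_zero_of_eventuallyEq_zero hU hUc hu hnull htU.1 ?_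
  have hp : 0 < S.coord i (z₀ + t • S.vec i) := by simp [hz₀i, S.coord_vec, ht]
  refine (hpos _ hp).symm.trans ?_
  filter_upwards [hU.mem_nhds htU.1] with y hy using hz' y hy

end DiracFrame

end Dirac

/-! ### The operators on slices and the representation formula. -/

namespace Octonion

theorem incl_single {p : ℕ} (hp : p ≤ 6) (i : Fin (p + 1)) :
    incl p (EuclideanSpace.single i 1) =
      EuclideanSpace.single (Fin.castLE (by omega) i : Fin 8) (1 : ℝ) := by
  ext k
  simp only [incl, PiLp.single_apply, Fin.ext_iff, Fin.val_castLE]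
  split_ifs <;> first | rfl | omega

theorem neg_mem_sphere {p : ℕ} {ω : Octonion} (hω : ω ∈ sphere p) : -ω ∈ sphere p :=
  ⟨fun i hi => by simp [hω.1 i hi], by simpa using hω.2⟩

theorem sphere_mul_mul_self {p : ℕ} {ω : Octonion} (hω : ω ∈ sphere p) (x : Octonion) :
    ω * (ω * x) = -x :=
  mul_mul_self_neg ω x (hω.1 0 (Nat.zero_le p)) hω.2

/-- For `i ≥ 1`, two anticommutations cancel in sign; `e₀` is the unit. -/
theorem incl_single_mul_mul_comm {p : ℕ} (hp : p ≤ 6) (i : Fin (p + 1)) {ω η : Octonion}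
    (hω : ω ∈ sphere p) (hη : η ∈ sphere p) (x : Octonion) :
    incl p (EuclideanSpace.single i 1) * (ω * (η * x)) =
      ω * (η * (incl p (EuclideanSpace.single i 1) * x)) := by
  rw [incl_single hp]
  rcases eq_or_ne i 0 with rfl | hi
  · rw [show (Fin.castLE (by omega) (0 : Fin (p + 1)) : Fin 8) = 0 from rfl, single_zero_mul,
      single_zero_mul]
  · have h0 : (EuclideanSpace.single (Fin.castLE (by omega) i : Fin 8) (1 : ℝ)) 0 = 0 := by
      have : (0 : Fin 8) ≠ Fin.castLE (by omega) i := fun h => hi (by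
        rw [Fin.ext_iff] at h ⊢; exact h.symm)
      simp [this]
    have horth : ∀ ω ∈ sphere p,
        ∑ k, (EuclideanSpace.single (Fin.castLE (by omega) i : Fin 8) (1 : ℝ)) k * ω k = 0 := by
      intro ω hω
      simpa [PiLp.single_apply] using hω.1 (Fin.castLE (by omega) i) (Nat.lt_succ_iff.1 i.2)
    rw [mul_mul_comm_neg _ ω _ h0 (hω.1 0 (Nat.zero_le p)) (horth ω hω),
      mul_mul_comm_neg _ η _ h0 (hη.1 0 (Nat.zero_le p)) (horth η hη), mul_neg', neg_neg]

/-- The unit octonions which are the coefficients of the operator on the slice of `ω`. -/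
noncomputable def sliceUnit (p : ℕ) (ω : Octonion) : Option (Fin (p + 1)) → Octonion
  | none => ω
  | some i => incl p (EuclideanSpace.single i 1)

theorem sum_sliceUnit_mul {p : ℕ} (hp : p ≤ 6) {ω : Octonion} (hω : ω ∈ sphere p)
    (i j : Option (Fin (p + 1))) :
    ∑ k, sliceUnit p ω i k * sliceUnit p ω j k = if i = j then 1 else 0 := by
  have horth : ∀ i : Fin (p + 1), ω (Fin.castLE (by omega) i) = 0 := fun i =>
    hω.1 _ (Nat.lt_succ_iff.1 i.2)
  rcases i with _ | i <;> rcases j with _ | j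
  · simpa [sliceUnit, pow_two] using hω.2
  · simp [sliceUnit, incl_single hp, PiLp.single_apply, horth]
  · simp [sliceUnit, incl_single hp, PiLp.single_apply, horth]
  · simp only [sliceUnit, incl_single hp, PiLp.single_apply, mul_ite, mul_one, mul_zero,
      Finset.sum_ite_eq', Finset.mem_univ, if_true, Option.some_inj]
    simp [Fin.ext_iff, eq_comm]

/-- The operator on the slice of `ω` as an operator of Dirac type. -/
noncomputable def sliceFrame {p : ℕ} (hp : p ≤ 6) {ω : Octonion} (hω : ω ∈ sphere p) :
    DiracFrame (Option (Fin (p + 1))) (EuclideanSpace ℝ (Fin (p + 1)) × ℝ) Octonion where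
  vec
    | none => (0, 1)
    | some i => (EuclideanSpace.single i 1, 0)
  coord
    | none => ContinuousLinearMap.snd ℝ _ _
    | some i => (EuclideanSpace.proj i).comp (ContinuousLinearMap.fst ℝ _ _)
  symb i := (leftMul (sliceUnit p ω i)).toContinuousLinearMap
  adj i := (leftMul (conj (sliceUnit p ω i))).toContinuousLinearMap
  sum_coord z := by
    rw [Fintype.sum_option]
    refine Prod.ext ?_ ?_
    · ext k
      simp [Prod.fst_sum, Pi.single_apply]
    · simp [Prod.snd_sum]
  coord_vec i j := by
    rcases i with _ | i <;> rcases j with _ | j <;> simp [PiLp.single_apply]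
  norm_sq_le z := by
    rw [Fintype.sum_option]
    -- The product carries the maximum norm, which is why only an inequality is available.
    have h1 : ‖z.1‖ ^ 2 = ∑ i, z.1 i ^ 2 := by simp [EuclideanSpace.norm_sq_eq]
    change _ ≤ z.2 ^ 2 + ∑ i, z.1 i ^ 2
    rw [← h1, Prod.norm_def]
    rcases max_cases ‖z.1‖ ‖z.2‖ with h | h <;> rw [h.1]
    · nlinarith [sq_nonneg z.2]
    · rw [Real.norm_eq_abs, sq_abs]
      nlinarith [sq_nonneg ‖z.1‖]
  clifford i j h := by
    simp only [LinearMap.coe_toContinuousLinearMap', leftMul_apply, conj_mul_mul_add,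
      sum_sliceUnit_mul hp hω]
    split_ifs <;> simp

theorem sliceFrame_dirac {p : ℕ} (hp : p ≤ 6) {ω : Octonion} (hω : ω ∈ sphere p)
    (F : EuclideanSpace ℝ (Fin (p + 1)) × ℝ → Octonion)
    (z : EuclideanSpace ℝ (Fin (p + 1)) × ℝ) :
    (sliceFrame hp hω).dirac F z = sliceDirac p ω F z := by
  rw [DiracFrame.dirac, Fintype.sum_option, add_comm, sliceDirac]
  rfl

theorem sliceDirac_sub {p : ℕ} (ω : Octonion)
    {F G : EuclideanSpace ℝ (Fin (p + 1)) × ℝ → Octonion}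
    {z : EuclideanSpace ℝ (Fin (p + 1)) × ℝ} (hF : DifferentiableAt ℝ F z)
    (hG : DifferentiableAt ℝ G z) :
    sliceDirac p ω (fun z => F z - G z) z = sliceDirac p ω F z - sliceDirac p ω G z := by
  simp only [sliceDirac, fderiv_fun_sub hF hG, _root_.sub_apply, mul_sub',
    Finset.sum_sub_distrib]
  abel

/-- The reflection `(x, r) ↦ (x, -r)`. -/
noncomputable def reflect (p : ℕ) : (EuclideanSpace ℝ (Fin (p + 1)) × ℝ) →L[ℝ]
    (EuclideanSpace ℝ (Fin (p + 1)) × ℝ) :=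
  (ContinuousLinearMap.fst ℝ _ _).prod (-ContinuousLinearMap.snd ℝ _ _)

theorem reflect_apply (p : ℕ) (z : EuclideanSpace ℝ (Fin (p + 1)) × ℝ) :
    reflect p z = (z.1, -z.2) := rfl

/-- The function on the slice of `ω` which is built from the values on the slice of `η`. -/
noncomputable def stemExtension (p : ℕ) (ω η : Octonion)
    (F : EuclideanSpace ℝ (Fin (p + 1)) × ℝ → Octonion)
    (z : EuclideanSpace ℝ (Fin (p + 1)) × ℝ) : Octonion :=
  (1 / 2 : ℝ) • (F z + F (reflect p z)) +
    (1 / 2 : ℝ) • (ω * (η * (F (reflect p z) - F z)))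

theorem contDiffOn_stemExtension {p : ℕ} (ω η : Octonion)
    {F : EuclideanSpace ℝ (Fin (p + 1)) × ℝ → Octonion}
    {U : Set (EuclideanSpace ℝ (Fin (p + 1)) × ℝ)} (hF : ContDiffOn ℝ 1 F U)
    (hU : Set.MapsTo (reflect p) U U) : ContDiffOn ℝ 1 (stemExtension p ω η F) U := by
  have hF' : ContDiffOn ℝ 1 (fun z => F (reflect p z)) U :=
    hF.comp (reflect p).contDiff.contDiffOn hU
  refine ((hF.add hF').const_smul _).add (ContDiffOn.const_smul _ ?_)
  exact ((leftMul ω).toContinuousLinearMap.contDiff.comp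
    (leftMul η).toContinuousLinearMap.contDiff).comp_contDiffOn (hF'.sub hF)

/-- With `a`, `b` the `r`-derivatives of `F` at `z` and at its reflection, the `eᵢ` part is `(-η(a +
b) + ω(b - a)) / 2` by the equation for `η`, and the `ω ∂_r` part is its negative. -/
theorem sliceDirac_stemExtension {p : ℕ} (hp : p ≤ 6) {ω η : Octonion} (hω : ω ∈ sphere p)
    (hη : η ∈ sphere p) {F : EuclideanSpace ℝ (Fin (p + 1)) × ℝ → Octonion}
    {z : EuclideanSpace ℝ (Fin (p + 1)) × ℝ} (hz : DifferentiableAt ℝ F z)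
    (hz' : DifferentiableAt ℝ F (reflect p z)) (h : sliceDirac p η F z = 0)
    (h' : sliceDirac p η F (reflect p z) = 0) :
    sliceDirac p ω (stemExtension p ω η F) z = 0 := by
  have hd : ∀ v, fderiv ℝ (stemExtension p ω η F) z v =
      (1 / 2 : ℝ) • (fderiv ℝ F z v + fderiv ℝ F (reflect p z) (reflect p v)) +
        (1 / 2 : ℝ) • (ω * (η * (fderiv ℝ F (reflect p z) (reflect p v) - fderiv ℝ F z v))) := by
    intro v
    have h1 := hz.hasFDerivAt
    have h2 := hz'.hasFDerivAt.comp z (reflect p).hasFDerivAt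
    have h3 := ((h1.add h2).const_smul (1 / 2 : ℝ)).add
      ((((leftMul ω).toContinuousLinearMap.comp
        (leftMul η).toContinuousLinearMap).hasFDerivAt.comp z (h2.sub h1)).const_smul (1 / 2 : ℝ))
    exact DFunLike.congr_fun (HasFDerivAt.fderiv h3) v
  simp only [sliceDirac] at h h' ⊢
  simp only [hd, reflect_apply, mul_add', mul_smul', Finset.sum_add_distrib, ← Finset.smul_sum,
    incl_single_mul_mul_comm hp _ hω hη, ← mul_sum', mul_sub', Finset.sum_sub_distrib,
    neg_zero, sphere_mul_mul_self hω]
  have hneg : ((0, -1) : EuclideanSpace ℝ (Fin (p + 1)) × ℝ) = -(0, 1) := by simp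
  rw [hneg, map_neg]
  rw [← reflect_apply]
  rw [eq_neg_of_add_eq_zero_left h, eq_neg_of_add_eq_zero_left h']
  simp only [mul_neg', sphere_mul_mul_self hη]
  module

/-- Symmetry extends to `r < 0` by passing to `-ω` and `-η`. Hence all slices are the same set in
coordinates. -/
theorem incl_add_smul_mem {p : ℕ} {Ω : Set Octonion} (hsymm : IsPSymmetric p Ω)
    {x : EuclideanSpace ℝ (Fin (p + 1))} {r : ℝ} {ω η : Octonion} (hω : ω ∈ sphere p)
    (hη : η ∈ sphere p) (h : incl p x + r • ω ∈ Ω) : incl p x + r • η ∈ Ω := by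
  rcases lt_trichotomy r 0 with hr | rfl | hr
  · have h1 := hsymm x (-r) (neg_pos.2 hr) (-ω) (neg_mem_sphere hω) (by simpa using h) (-η)
      (neg_mem_sphere hη)
    simpa using h1
  · simpa using h
  · exact hsymm x r hr ω hω h η hη

theorem mapsTo_reflect_slice {p : ℕ} {Ω : Set Octonion} (hsymm : IsPSymmetric p Ω)
    {ω : Octonion} (hω : ω ∈ sphere p) :
    Set.MapsTo (reflect p) (slice p Ω ω) (slice p Ω ω) := by
  intro z hz
  have := incl_add_smul_mem hsymm hω (neg_mem_sphere hω) hz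
  simpa [slice, reflect_apply] using this

/-- The representation formula in the coordinates of the slices. -/
theorem sliceFun_eq_stemExtension {p : ℕ} (hp : p ≤ 6) {Ω : Set Octonion}
    (hΩ : IsSliceDomain p Ω) (hsymm : IsPSymmetric p Ω) {f : Octonion → Octonion}
    (hf : IsPartialSliceMonogenicOn p f Ω) {ω η : Octonion} (hω : ω ∈ sphere p)
    (hη : η ∈ sphere p) {z : EuclideanSpace ℝ (Fin (p + 1)) × ℝ} (hz : z ∈ slice p Ω ω) :
    sliceFun p f ω z = stemExtension p ω η (sliceFun p f η) z := by
  have hslice : slice p Ω η = slice p Ω ω := Set.ext fun z =>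
    ⟨incl_add_smul_mem hsymm hη hω, incl_add_smul_mem hsymm hω hη⟩
  have hU := hΩ.isOpen_slice ω hω
  obtain ⟨hfω, hDω⟩ := hf ω hω
  obtain ⟨hfη, hDη⟩ := hf η hη
  rw [hslice] at hfη hDη
  have hmaps := mapsTo_reflect_slice hsymm hω
  have hst := contDiffOn_stemExtension ω η hfη hmaps
  have hdiff : ∀ {F : EuclideanSpace ℝ (Fin (p + 1)) × ℝ → Octonion},
      ContDiffOn ℝ 1 F (slice p Ω ω) → ∀ z ∈ slice p Ω ω, DifferentiableAt ℝ F z :=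
    fun hF z hz => (hF.contDiffAt (hU.mem_nhds hz)).differentiableAt (by simp)
  -- This point supplies `(x, 0)` on the hyperplane `r = 0`.
  obtain ⟨_, hy, x, rfl⟩ := hΩ.inter_nonempty
  refine sub_eq_zero.1 ((sliceFrame hp hω).eqOn_zero_of_eqOn_hyperplane hU
    (hΩ.isConnected_slice ω hω).isPreconnected
    (u := fun z => sliceFun p f ω z - stemExtension p ω η (sliceFun p f η) z)
    (hfω.sub hst) (fun z hz => ?_) none (z₀ := (x, 0)) ?_ rfl (fun z _ hz0 => ?_) z hz)
  · rw [sliceFrame_dirac, sliceDirac_sub ω (hdiff hfω z hz) (hdiff hst z hz), hDω z hz,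
      sliceDirac_stemExtension hp hω hη (hdiff hfη z hz) (hdiff hfη _ (hmaps hz)) (hDη z hz)
        (hDη _ (hmaps hz)), sub_zero]
  · simpa [slice] using hy
  · obtain ⟨y, r⟩ := z
    obtain rfl : r = 0 := hz0
    simp only [sliceFun, stemExtension, reflect_apply, neg_zero, zero_smul, add_zero, sub_self,
      mul_zero', smul_zero]
    module

theorem apply_eq_stemFst_add_mul_stemSnd {p : ℕ} (hp : p ≤ 6) {Ω : Set Octonion}
    (hΩ : IsSliceDomain p Ω) (hsymm : IsPSymmetric p Ω) {f : Octonion → Octonion}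
    (hf : IsPartialSliceMonogenicOn p f Ω) {ω η : Octonion} (hω : ω ∈ sphere p)
    (hη : η ∈ sphere p) {x : EuclideanSpace ℝ (Fin (p + 1))} {r : ℝ}
    (h : incl p x + r • ω ∈ Ω) :
    f (incl p x + r • ω) = stemFst p f η x r + ω * stemSnd p f η x r := by
  have := sliceFun_eq_stemExtension hp hΩ hsymm hf hω hη (z := (x, r)) h
  simpa [sliceFun, stemExtension, reflect_apply, stemFst, stemSnd, mul_smul',
    sub_eq_add_neg] using this

end Octonion

theorem mainTheorem1 (p : ℕ) (hp : p ≤ 6) (Ω : Set Octonion)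
    (hΩ : Octonion.IsSliceDomain p Ω) (hsymm : Octonion.IsPSymmetric p Ω)
    (f : Octonion → Octonion) (hf : Octonion.IsPartialSliceMonogenicOn p f Ω) :
    (∀ (x : EuclideanSpace ℝ (Fin (p + 1))) (r : ℝ), ∀ ω ∈ Octonion.sphere p,
      Octonion.incl p x + r • ω ∈ Ω → ∀ η ∈ Octonion.sphere p,
        f (Octonion.incl p x + r • ω) =
          (1 / 2 : ℝ) • (f (Octonion.incl p x + r • η) + f (Octonion.incl p x - r • η)) +
          (1 / 2 : ℝ) •
            (ω * (η * (f (Octonion.incl p x - r • η) - f (Octonion.incl p x + r • η))))) ∧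
    (∀ (x : EuclideanSpace ℝ (Fin (p + 1))) (r : ℝ),
      (∃ ω ∈ Octonion.sphere p, Octonion.incl p x + r • ω ∈ Ω) →
        ∀ η₁ ∈ Octonion.sphere p, ∀ η₂ ∈ Octonion.sphere p,
          Octonion.stemFst p f η₁ x r = Octonion.stemFst p f η₂ x r ∧
          Octonion.stemSnd p f η₁ x r = Octonion.stemSnd p f η₂ x r) := by
  refine ⟨fun x r ω hω h η hη => ?_, fun x r hex η₁ hη₁ η₂ hη₂ => ?_⟩
  · rw [Octonion.apply_eq_stemFst_add_mul_stemSnd hp hΩ hsymm hf hω hη h, Octonion.stemFst,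
      Octonion.stemSnd, Octonion.mul_smul']
  · obtain ⟨ω, hω, h⟩ := hex
    -- With `F₁`, `F₂` computed from `η₂`, the values of `f` at `x ± r η₁` are `F₁ ± η₁ F₂`; solving
    -- for `F₁` and `F₂` gives the expressions computed from `η₁`.
    have h1 := Octonion.apply_eq_stemFst_add_mul_stemSnd hp hΩ hsymm hf hη₁ hη₂
      (Octonion.incl_add_smul_mem hsymm hω hη₁ h)
    have h2 := Octonion.apply_eq_stemFst_add_mul_stemSnd hp hΩ hsymm hf
      (Octonion.neg_mem_sphere hη₁) hη₂
      (Octonion.incl_add_smul_mem hsymm hω (Octonion.neg_mem_sphere hη₁) h)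
    rw [smul_neg, ← sub_eq_add_neg, Octonion.neg_mul'] at h2
    constructor
    · rw [Octonion.stemFst, h1, h2]
      module
    · rw [Octonion.stemSnd, h1, h2]
      simp only [Octonion.mul_sub', Octonion.mul_add', Octonion.mul_neg',
        Octonion.sphere_mul_mul_self hη₁]
      module
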